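/- **Theorem (instability of the periodic orbit $13223122$).** Let $r\in\,]0,1[$ and $\alpha=(1+r)/2$. Consider four identical inelastic point particles on the line with restitution coefficient $r$. Write $p\in(\mathbb R_+)^3$ for the gaps between consecutive particles and $q\in\mathbb R^3$ for the relative velocities of consecutive particles. Collisions of the pairs 1-2, 2-3, 3-4 are called of type $\mathfrak a,\mathfrak b,\mathfrak c$, and act on $q$ by $$A=\begin{pmatrix}-r&0&0\\ \alpha&1&0\\0&0&1\end{pmatrix},\quad B=\begin{pmatrix}1&\alpha&0\\0&-r&0\\0&\alpha&1\end{pmatrix},\quad C=\begin{pmatrix}1&0&0\\0&1&\alpha\\0&0&-r\end{pmatrix}.$$ Only the plane $\mathrm{Span}[p,q]$ is recorded, through a unit normal vector $u=(x,y,z)$, where $u$ and $-u$ represent the same plane. Let $$X=\{|u|=1\}\cap\big(\{x\ge0,\ z\le0\}\cup\{x\le0,\ z\ge0\}\big),$$ and let $\widehat{\mathfrak P}_r$, with domain $X$, be the $\mathfrak b$-to-$\mathfrak b$ mapping. It sends the plane just after a collision of type $\mathfrak b$ to the plane just after the next collision of type $\mathfrak b$; for each collision on the way, with matrix $K\in\{A,B,C\}$,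 the plane is replaced by its image under $K$. Its value is the unit normal vector in $\{x\ge0,z\le0\}$. Explicitly, taking the representative of $u$ with $x\ge0,z\le0$, the collisions are * $\mathfrak{ab}$ (symbol $1$) if $y>0$ and $\alpha y-x>0$; * $\mathfrak{cb}$ (symbol $3$) if $y<0$ and $\alpha y-z<0$; * $\mathfrak{acb}$ or $\mathfrak{cab}$ (symbol $2$) otherwise. By convention this includes the limit cases $\alpha y=x$ or $\alpha y=z$ with a triple collision. A point $u\in X$ *generates the periodic orbit $13223122$* if the symbols of $u,\widehat{\mathfrak P}_r(u),\dots,\widehat{\mathfrak P}_r^{\,7}(u)$ are $1,3,2,2,3,1,2,2$ and $\widehat{\mathfrak P}_r^{\,8}(u)=\pm u$. The orbit of $u$ is *Lyapunov stable* if for every $\varepsilon>0$ there is $\delta>0$ such that $|\widehat{\mathfrak P}_r^{\,n}(v)-\widehat{\mathfrak P}_r^{\,n}(u)|<\varepsilon$ for all $n\ge0$ and all $v\in X$ with $|v-u|<\delta$. It is *locally attracting* if there is $\delta>0$ such that $|\widehat{\mathfrak P}_r^{\,n}(v)-\widehat{\mathfrak P}_r^{\,n}(u)|\to0$ as $n\to\infty$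 for all $v\in X$ with $|v-u|<\delta$. Then, for every $r\in\,]0,1[$, no point of $X$ generates the periodic orbit $13223122$ in a stable manner: if $u\in X$ generates it, then the orbit of $u$ is neither Lyapunov stable nor locally attracting. In particular it is not asymptotically stable. -/

import Mathlib

namespace FourParticles

/-!
Four identical inelastic point particles on the line, with restitution coefficient `r`.
The pairs 1-2, 2-3, 3-4 are indexed by `0, 1, 2 : Fin 3`; a collision of the pair `0`, `1`, `2`
is a collision of type a, b, c, respectively. A configuration is described by the gaps `p` and the
relative velocities `q` in `ℝ³`, and only the oriented plane spanned by `p` and `q` matters; it is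
encoded by its normal vector `q ∧ p`.
-/

/-- The constant `α = (1 + r) / 2`. -/
noncomputable def alpha (r : ℝ) : ℝ := (r + 1) / 2

/-- The collision matrices `A`, `B`, `C`: the action of a collision of type a, b, c on the
relative velocities. -/
noncomputable def collisionMatrix (r : ℝ) : Fin 3 → Matrix (Fin 3) (Fin 3) ℝ :=
  ![!![-r, 0, 0; alpha r, 1, 0; 0, 0, 1],
    !![1, alpha r, 0; 0, -r, 0; 0, alpha r, 1],
    !![1, 0, 0; 0, 1, alpha r; 0, 0, -r]]

/-- Effect of a collision of the pair `k` on the normal vector of the plane `Span[p, q]`.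
At the collision the plane is `Span[p', q]`, where `p'` has zero `k`-th entry and is therefore
fixed by the collision matrix `K`; the new plane `Span[p', K q]` is the image of the old one
under `K`. Since `(K q) ∧ (K p') = (adjugate K)ᵀ (q ∧ p')`, its oriented normal vector is the
following one. -/
noncomputable def collide (r : ℝ) (k : Fin 3) (u : Fin 3 → ℝ) : Fin 3 → ℝ :=
  (collisionMatrix r k).adjugate.transpose.mulVec u

/-- One cycle from a collision of type b to the next one, starting from the plane with normal
vector `u`: the list of the collisions, and the normal vector at the end of the cycle.
If the pair `k` has just collided, then with `e` the `k`-th basis vector, `p = u ∧ e`,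
`q = p ∧ u` and `v = u - (u ⬝ e) e` one has `q ⬝ v = - (u ⬝ e) * |v| ^ 2`. The sign of `u ⬝ e`,
that is, of the `k`-th entry of `u`, therefore decides which of the two other pairs collides
next: after b, the next collision is a if `0 < u 1` and c if `u 1 < 0`; after a, it is b if
`u 0 < 0` and c if `0 < u 0`; after c, it is b if `0 < u 2` and a if `u 2 < 0`. When the second
collision is not of type b, the third one is. In the limit cases where the sign is zero
(a and c simultaneous, or a triple collision), both a and c take place before b. -/
noncomputable def bBlock (r : ℝ) (u : Fin 3 → ℝ) : List (Fin 3) × (Fin 3 → ℝ) :=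
  if u 1 < 0 then
    if 0 < collide r 2 u 2 then ([2, 1], collide r 1 (collide r 2 u))
    else ([2, 0, 1], collide r 1 (collide r 0 (collide r 2 u)))
  else
    if collide r 0 u 0 < 0 then ([0, 1], collide r 1 (collide r 0 u))
    else ([0, 2, 1], collide r 1 (collide r 2 (collide r 0 u)))

/-- The domain `X` of the b-to-b mapping: the part of the unit sphere of `ℝ³` where `x ≥ 0, z ≤ 0`
or `x ≤ 0, z ≥ 0`. -/
def X : Set (EuclideanSpace ℝ (Fin 3)) :=
  {u | ‖u‖ = 1 ∧ ((0 ≤ u 0 ∧ u 2 ≤ 0) ∨ (u 0 ≤ 0 ∧ 0 ≤ u 2))}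

open Classical in
/-- The vectors `u` and `-u` define the same plane; the representative in `x ≥ 0, z ≤ 0`
of a point of `X`. -/
noncomputable def rep (u : EuclideanSpace ℝ (Fin 3)) : Fin 3 → ℝ :=
  if 0 ≤ u 0 ∧ u 2 ≤ 0 then u.ofLp else (-u).ofLp

/-- The b-to-b mapping on `X`, acting on unit normal vectors of planes. -/
noncomputable def bToB (r : ℝ) (u : EuclideanSpace ℝ (Fin 3)) : EuclideanSpace ℝ (Fin 3) :=
  let w : EuclideanSpace ℝ (Fin 3) := WithLp.toLp 2 (bBlock r (rep u)).2
  ‖w‖⁻¹ • w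

/-- The symbol of the cycle that starts at `u`: `1` for the collisions ab, `3` for cb,
and `2` for acb or cab. -/
noncomputable def symbol (r : ℝ) (u : EuclideanSpace ℝ (Fin 3)) : ℕ :=
  if (bBlock r (rep u)).1 = [0, 1] then 1
  else if (bBlock r (rep u)).1 = [2, 1] then 3
  else 2

/-- `u` generates the periodic orbit with pattern `w`: the successive cycles of the orbit of `u`
have the symbols of `w`, after which the initial plane is reached again. -/
def Generates (r : ℝ) (w : List ℕ) (u : EuclideanSpace ℝ (Fin 3)) : Prop :=
  (∀ k (hk : k < w.length), symbol r ((bToB r)^[k] u) = w[k]) ∧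
    ((bToB r)^[w.length] u = u ∨ (bToB r)^[w.length] u = -u)

/-- The orbit of `u` is stable in the sense of Lyapunov. -/
def LyapunovStable (r : ℝ) (u : EuclideanSpace ℝ (Fin 3)) : Prop :=
  ∀ ε > 0, ∃ δ > 0, ∀ v ∈ X, dist v u < δ →
    ∀ n : ℕ, dist ((bToB r)^[n] v) ((bToB r)^[n] u) < ε

/-- The orbit of `u` attracts the orbits of all the points of `X` close to `u`. -/
def LocallyAttracting (r : ℝ) (u : EuclideanSpace ℝ (Fin 3)) : Prop :=
  ∃ δ > 0, ∀ v ∈ X, dist v u < δ →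
    Filter.Tendsto (fun n : ℕ => dist ((bToB r)^[n] v) ((bToB r)^[n] u)) Filter.atTop (nhds 0)

end FourParticles

namespace FourParticles

/-! The word 13223122 is 1322 followed by its mirror image 3122. Hence the period matrix on normal
vectors is the square of `half`, the linear map "four cycles 1322, then reflect". A generating `u`
in the cone is an eigenvector of that square for some `lam > 0`. The inequalities on `u` used here
define a convex cone, so adding a suitable positive multiple of `half r u` to `u` yields an
eigenvector of `half` itself, for `√lam`, that satisfies them too.

In suitable coordinates the eigenvector equations and these inequalities force `κ = (1 - r)² / (2r)
> 5/2` (`five_halves_lt_kappa`). In that range the characteristic polynomial of `half / r ^ 6` has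
another real root, negative and of larger modulus (`char_coeff_bounds`, `exists_root_lt_neg`). Its
left eigenvector is a functional `φ` that the period matrix multiplies by some `σ > lam`
(`exists_expanding_functional`).

On unit vectors, an orbit that shadows the periodic one sees `|φ|` grow by a factor of nearly `σ /
lam` per period, which is impossible for bounded `φ` unless `φ` vanishes there. By Baire,
arbitrarily close to `u` there are points on whose whole orbit `φ` is nonzero (`exists_generic`).
The mapping is discontinuous at triple collisions, so it must also be shown that shadowing orbits
have the same symbols: `exists_dist_lt_follows`. -/

/-! ### Cycles as linear maps on the cone of representatives -/

/-- The matrix of a cycle of the b-to-b mapping, acting on normal vectors; the cycles ab, acb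
(or cab) and cb are indexed by `0`, `1`, `2`. -/
noncomputable def blockMatrix (r : ℝ) : Fin 3 → Matrix (Fin 3) (Fin 3) ℝ :=
  ![!![-r, r * alpha r, 0; -alpha r, alpha r ^ 2 - r, r * alpha r; 0, 0, r ^ 2],
    !![r ^ 2, -(r ^ 2 * alpha r), 0;
      r * alpha r, r ^ 2 - 2 * r * alpha r ^ 2, r * alpha r; 0, -(r ^ 2 * alpha r), r ^ 2],
    !![r ^ 2, 0, 0; r * alpha r, alpha r ^ 2 - r, -alpha r; 0, r * alpha r, -r]]

/-- The index of the cycle that starts at the plane with normal vector `v`. -/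
noncomputable def cycle (r : ℝ) (v : Fin 3 → ℝ) : Fin 3 :=
  if v 0 < alpha r * v 1 then 0 else if alpha r * v 1 < v 2 then 2 else 1

/-- The cone of the chosen representatives. -/
def Cone (v : Fin 3 → ℝ) : Prop := 0 ≤ v 0 ∧ v 2 ≤ 0

lemma alpha_pos {r : ℝ} (hr : 0 < r) : 0 < alpha r := by unfold alpha; linarith

lemma det_blockMatrix_ne_zero {r : ℝ} (hr : 0 < r) (s : Fin 3) : (blockMatrix r s).det ≠ 0 := by
  have h4 : r ^ 4 ≠ 0 := by positivity
  have h6 : r ^ 6 ≠ 0 := by positivity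
  fin_cases s <;> simp only [blockMatrix, Matrix.det_fin_three] <;> simp <;> ring_nf <;> assumption

lemma collide_zero (r : ℝ) (u : Fin 3 → ℝ) :
    collide r 0 u = ![u 0 - alpha r * u 1, -r * u 1, -r * u 2] := by
  ext i
  fin_cases i <;>
    simp [collide, collisionMatrix, Matrix.adjugate_fin_three, Matrix.mulVec, dotProduct,
      Fin.sum_univ_three] <;> ring

lemma collide_one (r : ℝ) (u : Fin 3 → ℝ) :
    collide r 1 u = ![-r * u 0, -alpha r * u 0 + u 1 - alpha r * u 2, -r * u 2] := by
  ext i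
  fin_cases i <;>
    simp [collide, collisionMatrix, Matrix.adjugate_fin_three, Matrix.mulVec, dotProduct,
      Fin.sum_univ_three] <;> ring

lemma collide_two (r : ℝ) (u : Fin 3 → ℝ) :
    collide r 2 u = ![-r * u 0, -r * u 1, u 2 - alpha r * u 1] := by
  ext i
  fin_cases i <;>
    simp [collide, collisionMatrix, Matrix.adjugate_fin_three, Matrix.mulVec, dotProduct,
      Fin.sum_univ_three] <;> ring

lemma blockMatrix_zero_mulVec (r : ℝ) (v : Fin 3 → ℝ) : (blockMatrix r 0).mulVec v =
    ![r * (alpha r * v 1 - v 0),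
      alpha r * (alpha r * v 1 - v 0) - r * v 1 + r * alpha r * v 2, r ^ 2 * v 2] := by
  ext i
  fin_cases i <;> simp [blockMatrix, Matrix.mulVec, dotProduct, Fin.sum_univ_three] <;> ring

lemma blockMatrix_one_mulVec (r : ℝ) (v : Fin 3 → ℝ) : (blockMatrix r 1).mulVec v =
    ![r ^ 2 * (v 0 - alpha r * v 1),
      r ^ 2 * v 1 + r * alpha r * (v 0 + v 2 - 2 * (alpha r * v 1)),
      r ^ 2 * (v 2 - alpha r * v 1)] := by
  ext i
  fin_cases i <;> simp [blockMatrix, Matrix.mulVec, dotProduct, Fin.sum_univ_three] <;> ring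

lemma blockMatrix_two_mulVec (r : ℝ) (v : Fin 3 → ℝ) : (blockMatrix r 2).mulVec v =
    ![r ^ 2 * v 0, r * alpha r * v 0 - r * v 1 + alpha r * (alpha r * v 1 - v 2),
      r * (alpha r * v 1 - v 2)] := by
  ext i
  fin_cases i <;> simp [blockMatrix, Matrix.mulVec, dotProduct, Fin.sum_univ_three] <;> ring

/-- On the cone `x ≥ 0 ≥ z`, so `x < αy` forces `y > 0` and `αy < z` forces `y < 0`. The preliminary
test on the sign of `y` is therefore redundant. -/
lemma bBlock_eq {r : ℝ} (hr : 0 < r) {v : Fin 3 → ℝ} (hv : Cone v) :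
    (bBlock r v).2 = (blockMatrix r (cycle r v)).mulVec v ∧
    ((bBlock r v).1 = [0, 1] ↔ cycle r v = 0) ∧ ((bBlock r v).1 = [2, 1] ↔ cycle r v = 2) := by
  have ha := alpha_pos hr
  obtain ⟨h0, h2⟩ := hv
  by_cases hy : v 1 < 0
  · have h1 : alpha r * v 1 < 0 := mul_neg_of_pos_of_neg ha hy
    have h3 : ¬ v 0 < alpha r * v 1 := by linarith
    by_cases hz : alpha r * v 1 < v 2
    · simp only [bBlock, cycle, hy, h3, hz, if_true, if_false, collide_two, blockMatrix_two_mulVec,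
        collide_one]
      simp [hz]
      ring_nf
      simp
    · simp only [bBlock, cycle, hy, h3, hz, if_true, if_false, collide_two, blockMatrix_one_mulVec,
        collide_one, collide_zero]
      simp [hz]
      ring_nf
      simp
  · have h1 : 0 ≤ alpha r * v 1 := mul_nonneg ha.le (not_lt.1 hy)
    have h3 : ¬ alpha r * v 1 < v 2 := by linarith
    by_cases hz : v 0 < alpha r * v 1
    · simp only [bBlock, cycle, hy, hz, if_true, if_false, collide_zero, blockMatrix_zero_mulVec,
        collide_one]
      simp [hz]
      ring_nf
      simp
    · simp only [bBlock, cycle, hy, h3, hz, if_false, collide_two, blockMatrix_one_mulVec,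
        collide_one, collide_zero]
      simp [hz]
      ring_nf
      simp

lemma Cone.blockMatrix_mulVec {r : ℝ} (hr : 0 < r) {v : Fin 3 → ℝ} (hv : Cone v) :
    Cone ((blockMatrix r (cycle r v)).mulVec v) := by
  obtain ⟨h0, h2⟩ := hv
  unfold cycle
  split_ifs with h h'
  · rw [blockMatrix_zero_mulVec]
    exact ⟨by simpa using mul_nonneg hr.le (sub_nonneg.2 h.le),
      by simpa using mul_nonpos_of_nonneg_of_nonpos (sq_nonneg r) h2⟩
  · rw [blockMatrix_two_mulVec]
    exact ⟨by simpa using mul_nonneg (sq_nonneg r) h0,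
      by simpa using mul_nonpos_of_nonneg_of_nonpos hr.le (sub_nonpos.2 h'.le)⟩
  · rw [blockMatrix_one_mulVec]
    exact ⟨by simpa using mul_nonneg (sq_nonneg r) (sub_nonneg.2 (not_lt.1 h)),
      by simpa using mul_nonpos_of_nonneg_of_nonpos (sq_nonneg r) (sub_nonpos.2 (not_lt.1 h'))⟩

lemma cycle_smul (r : ℝ) {c : ℝ} (hc : 0 < c) (v : Fin 3 → ℝ) : cycle r (c • v) = cycle r v := by
  have h (a : ℝ) : alpha r * (c * a) = c * (alpha r * a) := by ring
  simp only [cycle, Pi.smul_apply, smul_eq_mul, h, mul_lt_mul_iff_right₀ hc]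


/-! ### The reduced eigenvalue problem -/

/-- Existence constraint: `h1`–`h3` say that `(d, β, γ)` is an eigenvector of the reduced
half-period map for `m`; `hβ`, `hγ`, `hs` are the collision inequalities. `h3` bounds `m`, `h2` then
excludes `κ ≤ 2`, and `h1` excludes the remaining interval up to `5/2`. -/
lemma five_halves_lt_kappa {r κ η d β γ b m : ℝ} (hr0 : 0 < r) (hr1 : r < 1)
    (hκ : 2 * r * κ = (1 - r) ^ 2) (hη : η = 1 - r * κ / 2)
    (hβ : 0 < β) (hγ : 0 ≤ γ) (hb : b = 2 * d - κ * β / 2 - η * γ)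
    (hs : 2 * r * γ ≤ κ * (b - r * β)) (hm : 0 < m)
    (h1 : m * d = (b + r * β) / 2)
    (h2 : m * γ = b - κ * ((κ - 1) * b / 2 - (κ + 1) * r * β / 2 - r * γ))
    (h3 : m * (β + κ * γ) = r * (κ * β + γ)) : 5 / 2 < κ := by
  have hκ0 : 0 < κ := by
    have : 0 < 2 * r * κ := by rw [hκ]; exact pow_pos (by linarith) 2
    exact pos_of_mul_pos_right this (by linarith)
  have hκr : r * κ < 1 / 2 := by nlinarith
  have hB : b * ((2 - κ) * (κ + 1)) = 2 * (m * γ) - κ * (κ + 1) * r * β - 2 * κ * r * γ := by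
    linear_combination -2 * h2
  have hβγ : 0 < β + κ * γ := by positivity
  -- For `κ < 1` one has `(2 - κ)(κ + 1) ≥ 2`, so `hB` with `m κ ≤ r` gives `κ b < r γ`, whereas
  -- `hs` gives `κ b > 2 r γ`.
  rcases lt_or_ge κ 1 with hk | hk
  · exfalso
    have hmk : m * κ ≤ r := by
      have : m * κ * (β + κ * γ) ≤ r * (β + κ * γ) := by
        have : r * (κ ^ 2 * β) ≤ r * (1 * β) := by gcongr; nlinarith
        linear_combination κ * h3 + this
      exact le_of_mul_le_mul_right this hβγ
    have hb0 : 0 < κ * b := by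
      have : 0 ≤ r * γ := by positivity
      have : 0 < κ * (r * β) := by positivity
      linarith
    have hb0' : 2 * (κ * b) ≤ κ * b * ((2 - κ) * (κ + 1)) := by
      have : 0 ≤ κ * b * (κ * (1 - κ)) := mul_nonneg hb0.le (mul_nonneg hκ0.le (by linarith))
      linarith
    have : m * κ * γ ≤ r * γ := by gcongr
    have p1 : 0 < κ * (κ * (κ + 1) * r * β) := by positivity
    have p2 : 0 ≤ κ * (2 * κ * r * γ) := by positivity
    have p3 : 0 < κ * (r * β) := by positivity
    have p4 : 0 ≤ r * γ := by positivity
    have hB' : κ * b * ((2 - κ) * (κ + 1)) =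
        2 * (m * κ * γ) - κ * (κ * (κ + 1) * r * β) - κ * (2 * κ * r * γ) := by
      linear_combination κ * hB
    linarith
  · have hmk : m ≤ r * κ := by
      have : m * (β + κ * γ) ≤ r * κ * (β + κ * γ) := by
        have : r * (1 * γ) ≤ r * (κ ^ 2 * γ) := by gcongr; nlinarith
        linear_combination h3 + this
      exact le_of_mul_le_mul_right this hβγ
    have hmg : 0 ≤ (r * κ - m) * γ := mul_nonneg (by linarith) hγ
    have p1 : 0 < κ * (κ + 1) * r * β := by positivity
    have hbpos : 0 < b := by
      have : 0 < κ * (b - r * β) ∨ 0 = κ * (b - r * β) := by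
        apply lt_or_eq_of_le; exact le_trans (by positivity) hs
      have h5 : 0 ≤ b - r * β := by
        rcases this with h | h
        · exact (pos_of_mul_pos_right h hκ0.le).le
        · rcases mul_eq_zero.1 h.symm with h | h
          · linarith
          · exact h.ge
      have : 0 < r * β := by positivity
      linarith
    by_contra hcon
    -- Since `m ≤ rκ`, the right side of `hB` is negative while `b > 0`.
    have hk2 : 2 < κ := by
      by_contra h
      have : 0 ≤ b * ((2 - κ) * (κ + 1)) :=
        mul_nonneg hbpos.le (mul_nonneg (by linarith) (by linarith))
      linarith
    -- From `hB` with `κ - 2 ≤ 1/2`; the factor `8/7` is `4 / (κ + 1)` at `κ = 5/2`.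
    have hb2 : 2 * κ * r * β + 8 / 7 * ((r * κ - m) * γ) ≤ b := by
      have e1 : b * ((κ - 2) * (κ + 1)) ≤ b * (1 / 2 * (κ + 1)) := by
        gcongr; linarith
      have e2 : (2 * κ * r * β) * (κ + 1) + 4 * ((r * κ - m) * γ) ≤ b * (κ + 1) := by linarith
      have e3 : 8 / 7 * ((r * κ - m) * γ) * (κ + 1) ≤ 4 * ((r * κ - m) * γ) := by nlinarith
      have : (2 * κ * r * β + 8 / 7 * ((r * κ - m) * γ)) * (κ + 1) ≤ b * (κ + 1) := by linarith
      exact le_of_mul_le_mul_right this (by linarith)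
    -- Eliminates `d` between `h1` and `hb`. As `m < 1/2`, the left side is at least `b / 2`, and
    -- `hb2` makes that too large.
    have hE : b * (1 - m) = r * (κ ^ 2 / 2 - 1) * β + κ * r * γ / 2 - (κ ^ 2 / 2 - η) * (m * γ) := by
      linear_combination -2 * h1 - m * hb + κ / 2 * h3
    have hbm : b / 2 ≤ b * (1 - m) := by nlinarith
    have q1 : 0 < r * β * (κ + 1 - κ ^ 2 / 2) := by
      have : 0 < κ + 1 - κ ^ 2 / 2 := by nlinarith
      positivity
    have q2 : 0 ≤ r * κ * γ := by positivity
    have q3 : 0 ≤ (κ ^ 2 / 2 - η - 4 / 7) * (m * γ) := by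
      have : 0 ≤ κ ^ 2 / 2 - η - 4 / 7 := by nlinarith
      positivity
    linarith

/-- Bounds for the first two coefficients of the characteristic polynomial of the reduced map. -/
lemma char_coeff_bounds {r κ η T : ℝ} (hr0 : 0 < r) (hr1 : r < 1)
    (hκ : 2 * r * κ = (1 - r) ^ 2) (hη : η = 1 - r * κ / 2) (hT : T = (κ - 2) * (κ + 1) / 2)
    (hk : 5 / 2 < κ) :
    1 + 2 * κ * r - κ ^ 2 * (κ + 1) * r / 2 + T * (2 * η - κ ^ 2) / 2 < -1 ∧
    κ * r * (3 - κ ^ 2 + T * (η - 1 / 2) + (κ - 1) * r / 2) < - r ^ 2 := by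
  have hr6 : r < 1 / 6 := by nlinarith
  have hκr : r * κ < 1 / 2 := by nlinarith
  have hκr' : 1 / 3 < r * κ := by nlinarith
  have hT0 : 7 / 8 < T := by rw [hT]; nlinarith
  have hη1 : η < 1 := by rw [hη]; linarith
  constructor
  · have a1 : 35 / 4 * (1 / 3) < κ * (κ + 1) * (r * κ) := by
      have : 35 / 4 < κ * (κ + 1) := by nlinarith
      gcongr
    have a2 : T * (2 * η - κ ^ 2) < T * (-17 / 4) := by
      gcongr; nlinarith
    nlinarith
  · have a3 : T * (η - 1 / 2) < T * (1 / 2) := by gcongr; linarith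
    have a4 : 3 - κ ^ 2 + T * (η - 1 / 2) + (κ - 1) * r / 2 < -2 := by nlinarith
    have a5 : (κ * r) * (3 - κ ^ 2 + T * (η - 1 / 2) + (κ - 1) * r / 2) < (κ * r) * (-2) := by
      gcongr
    nlinarith

/-- Subtracting the equation at `m`, the value of the cubic at `-m` is `-2 (e₁ m² + D)`. It is
positive: otherwise `m² ≥ -e₂`, whence `D ≥ e₁ e₂`. The cubic tends to `-∞` at `-∞`, so it vanishes
to the left of `-m`. -/
lemma exists_root_lt_neg {e₁ e₂ D m : ℝ} (he₁ : e₁ < 0) (hm : 0 < m) (he : D < e₁ * e₂)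
    (hroot : m ^ 3 - e₁ * m ^ 2 + e₂ * m - D = 0) :
    ∃ t < -m, t ^ 3 - e₁ * t ^ 2 + e₂ * t - D = 0 := by
  have h1 : e₁ * m ^ 2 + D < 0 := by
    by_contra h
    have : 0 ≤ m * (m ^ 2 + e₂) := by nlinarith
    have : 0 ≤ m ^ 2 + e₂ := nonneg_of_mul_nonneg_right this hm
    nlinarith
  set f : ℝ → ℝ := fun t => t ^ 3 - e₁ * t ^ 2 + e₂ * t - D with hf
  have hfm : 0 < f (-m) := by simp only [hf]; nlinarith
  set Y := 1 + m + |e₁| + |e₂| + |D| with hY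
  have hYm : m < Y := by
    rw [hY]
    linarith [abs_nonneg e₁, abs_nonneg e₂, abs_nonneg D]
  have hfY : f (-Y) < 0 := by
    have a1 := abs_nonneg e₁; have a2 := abs_nonneg e₂; have a3 := abs_nonneg D
    have b1 := neg_abs_le e₁; have b2 := neg_abs_le e₂; have b3 := neg_abs_le D
    have hY1 : 1 ≤ Y := by linarith
    have hYY : Y ≤ Y ^ 2 := by nlinarith
    have c1 : -e₁ * Y ^ 2 ≤ |e₁| * Y ^ 2 := by gcongr; linarith
    have c2 : -e₂ * Y ≤ |e₂| * Y ^ 2 := by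
      have : -e₂ * Y ≤ |e₂| * Y := by gcongr; linarith
      have : |e₂| * Y ≤ |e₂| * Y ^ 2 := by gcongr
      linarith
    have c3 : -D ≤ |D| * Y ^ 2 := by nlinarith
    have c4 : Y ^ 3 = (1 + m) * Y ^ 2 + |e₁| * Y ^ 2 + |e₂| * Y ^ 2 + |D| * Y ^ 2 := by
      rw [pow_succ' Y 2]; nth_rewrite 1 [hY]; ring
    have : 0 < (1 + m) * Y ^ 2 := by positivity
    simp only [hf]; nlinarith
  have hc : Continuous f := by simp only [hf]; fun_prop
  obtain ⟨t, ht, h0⟩ := intermediate_value_Ioo (by linarith : -Y ≤ -m) hc.continuousOn ⟨hfY, hfm⟩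
  exact ⟨t, ht.2, h0⟩

/-- Works in the coordinates `d`, `β + κγ`, `γ`. The given positive eigenvector makes `m` a root of
the characteristic cubic; the root below `-m` supplies the eigenvalue of a left eigenvector. -/
lemma exists_left_eigenvector {r κ η d β γ b m : ℝ} (hr0 : 0 < r) (hr1 : r < 1)
    (hκ : 2 * r * κ = (1 - r) ^ 2) (hη : η = 1 - r * κ / 2)
    (hβ : 0 < β) (hγ : 0 ≤ γ) (hb : b = 2 * d - κ * β / 2 - η * γ)
    (hs : 2 * r * γ ≤ κ * (b - r * β)) (hm : 0 < m)
    (h1 : m * d = (b + r * β) / 2)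
    (h2 : m * γ = b - κ * ((κ - 1) * b / 2 - (κ + 1) * r * β / 2 - r * γ))
    (h3 : m * (β + κ * γ) = r * (κ * β + γ)) :
    ∃ t < -m, ∃ l₁ l₂ l₃ : ℝ, l₁ ≠ 0 ∧ ∀ d β γ d' β' γ' b : ℝ,
      b = 2 * d - κ * β / 2 - η * γ → d' = (b + r * β) / 2 →
      γ' = b - κ * ((κ - 1) * b / 2 - (κ + 1) * r * β / 2 - r * γ) →
      β' + κ * γ' = r * (κ * β + γ) →
      l₁ * d' + l₂ * (β' + κ * γ') + l₃ * γ' =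
        t * (l₁ * d + l₂ * (β + κ * γ) + l₃ * γ) := by
  have hk := five_halves_lt_kappa hr0 hr1 hκ hη hβ hγ hb hs hm h1 h2 h3
  obtain ⟨T, hT⟩ : ∃ T, T = (κ - 2) * (κ + 1) / 2 := ⟨_, rfl⟩
  obtain ⟨b1, b2⟩ := char_coeff_bounds hr0 hr1 hκ hη hT hk
  obtain ⟨h, hh⟩ : ∃ h, h = r / 2 - κ / 4 := ⟨_, rfl⟩
  obtain ⟨G, hG⟩ : ∃ G, G = κ * (T + (κ + 1) * r) / 2 := ⟨_, rfl⟩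
  have hchar : ∀ t : ℝ, 2 * T * (t - κ * r) * (-κ * h - η / 2)
      - r * (κ ^ 2 - 1) * (2 * T * h + G * (1 - t))
      + (1 - t) * (t - κ * r) * (T * η + κ * r - κ * G - t) =
      t ^ 3 - (1 + 2 * κ * r - κ ^ 2 * (κ + 1) * r / 2 + T * (2 * η - κ ^ 2) / 2) * t ^ 2 +
        (κ * r * (3 - κ ^ 2 + T * (η - 1 / 2) + (κ - 1) * r / 2)) * t - r ^ 2 := by
    intro t
    rw [hG, hh, hT]
    ring
  have e1 : (1 - m) * d + h * (β + κ * γ) + (-κ * h - η / 2) * γ = 0 := by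
    rw [hh]; linear_combination -h1 - hb / 2
  have e2 : (κ * r - m) * (β + κ * γ) - r * (κ ^ 2 - 1) * γ = 0 := by
    linear_combination -h3
  have e3 : -2 * T * d + G * (β + κ * γ) + (T * η + κ * r - κ * G - m) * γ = 0 := by
    rw [hG, hT]; linear_combination -h2 + (κ - 2) * (κ + 1) / 2 * hb
  have hκ0 : 0 < κ := by linarith
  have hβγ : 0 < β + κ * γ := by positivity
  have hroot := hchar m
  -- Eliminates `d` and `γ` from `e1`, `e2`, `e3`, leaving the characteristic polynomial times the
  -- nonzero coordinate `β + κγ`.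
  have hzero : (β + κ * γ) * (2 * T * (m - κ * r) * (-κ * h - η / 2)
      - r * (κ ^ 2 - 1) * (2 * T * h + G * (1 - m))
      + (1 - m) * (m - κ * r) * (T * η + κ * r - κ * G - m)) = 0 := by
    linear_combination -r * (κ ^ 2 - 1) * (2 * T * e1 + (1 - m) * e3) -
      (2 * T * (-κ * h - η / 2) + (1 - m) * (T * η + κ * r - κ * G - m)) * e2
  rw [(mul_eq_zero.1 hzero).resolve_left hβγ.ne'] at hroot
  have he := mul_lt_mul'' (lt_neg_of_lt_neg b1) (lt_neg_of_lt_neg b2) zero_le_one (sq_nonneg r)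
  rw [one_mul, neg_mul_neg] at he
  obtain ⟨t, ht, hroot⟩ := exists_root_lt_neg (b1.trans (by norm_num)) hm he hroot.symm
  rw [← hchar t] at hroot
  have hT0 : 0 < T := by
    rw [hT]; exact div_pos (mul_pos (by linarith) (by linarith)) two_pos
  have hκr : 0 < κ * r := by positivity
  -- The coefficients are cofactors: two components of the left eigenvector equation hold
  -- identically, and the `γ` component is `hroot`. The first coefficient is nonzero because `t < 0
  -- < κ r` and `T > 0`.
  refine ⟨t, ht, 2 * T * (t - κ * r), 2 * T * h + G * (1 - t), (1 - t) * (t - κ * r),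
    mul_ne_zero (by positivity) (by linarith), ?_⟩
  intro d β γ d' β' γ' b hb hd' hγ' hβ'
  rw [hβ', hγ', hd', hb]
  rw [hG, hh, hT] at hroot ⊢
  linear_combination γ * hroot

/-! ### Mirror symmetry and the half period -/

/-- The reflection of the line, acting on normal vectors of planes in the cone. -/
def flip (v : Fin 3 → ℝ) : Fin 3 → ℝ := ![-v 2, -v 1, -v 0]

lemma flip_flip (v : Fin 3 → ℝ) : flip (flip v) = v := by
  ext i; fin_cases i <;> simp [flip]

lemma flip_add (v w : Fin 3 → ℝ) : flip (v + w) = flip v + flip w := by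
  ext i; fin_cases i <;> simp [flip] <;> ring

lemma flip_smul (c : ℝ) (v : Fin 3 → ℝ) : flip (c • v) = c • flip v := by
  ext i; fin_cases i <;> simp [flip]

lemma Cone.flip {v : Fin 3 → ℝ} (hv : Cone v) : Cone (flip v) :=
  ⟨by simpa [FourParticles.flip] using hv.2, by simpa [FourParticles.flip] using hv.1⟩

lemma flip_blockMatrix_mulVec (r : ℝ) (s : Fin 3) (v : Fin 3 → ℝ) :
    flip ((blockMatrix r s).mulVec v) = (blockMatrix r s.rev).mulVec (flip v) := by
  ext i
  fin_cases s <;> fin_cases i <;>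
    simp [flip, blockMatrix, Matrix.mulVec, dotProduct, Fin.sum_univ_three, Fin.rev] <;> ring

/-- Four successive cycles with the symbols 1, 3, 2, 2, followed by the reflection. -/
noncomputable def half (r : ℝ) (v : Fin 3 → ℝ) : Fin 3 → ℝ :=
  flip ((blockMatrix r 1).mulVec ((blockMatrix r 1).mulVec
    ((blockMatrix r 2).mulVec ((blockMatrix r 0).mulVec v))))

lemma half_add_smul (r : ℝ) (v w : Fin 3 → ℝ) (c : ℝ) :
    half r (v + c • w) = half r v + c • half r w := by
  simp only [half, Matrix.mulVec_add, Matrix.mulVec_smul, flip_add, flip_smul]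

/-- The reflection conjugates cycle 1 with cycle 3 and fixes cycle 2, so the second pass through
1322 becomes 3122 and the two reflections cancel. -/
lemma half_half (r : ℝ) (v : Fin 3 → ℝ) : half r (half r v) =
    (blockMatrix r 1).mulVec ((blockMatrix r 1).mulVec ((blockMatrix r 0).mulVec
      ((blockMatrix r 2).mulVec ((blockMatrix r 1).mulVec ((blockMatrix r 1).mulVec
        ((blockMatrix r 2).mulVec ((blockMatrix r 0).mulVec v))))))) := by
  have h0 : Fin.rev (0 : Fin 3) = 2 := rfl
  have h1 : Fin.rev (1 : Fin 3) = 1 := rfl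
  have h2 : Fin.rev (2 : Fin 3) = 0 := rfl
  conv_lhs => rw [half]
  simp only [flip_blockMatrix_mulVec, h0, h1, h2]
  simp only [half, flip_flip]

/-- The linear constraints that four cycles with the symbols 1, 3, 2, 2 impose on the initial
plane (only those that are used below). -/
structure Admissible (r : ℝ) (v : Fin 3 → ℝ) : Prop where
  nonpos : v 2 ≤ 0
  lt : v 0 < alpha r * v 1
  le : alpha r * (blockMatrix r 2).mulVec ((blockMatrix r 0).mulVec v) 1 ≤
    (blockMatrix r 2).mulVec ((blockMatrix r 0).mulVec v) 0

lemma Admissible.add_smul {r c : ℝ} {v w : Fin 3 → ℝ} (hv : Admissible r v)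
    (hw : Admissible r w) (hc : 0 ≤ c) : Admissible r (v + c • w) := by
  have h1 := mul_le_mul_of_nonneg_left hw.nonpos hc
  have h2 := mul_le_mul_of_nonneg_left hw.lt.le hc
  have h3 := mul_le_mul_of_nonneg_left hw.le hc
  have h4 := hv.nonpos
  have h5 := hv.lt
  have h6 := hv.le
  refine ⟨?_, ?_, ?_⟩
  · simp only [Pi.add_apply, Pi.smul_apply, smul_eq_mul]; linarith
  · simp only [Pi.add_apply, Pi.smul_apply, smul_eq_mul]; linarith
  · simp only [Matrix.mulVec_add, Matrix.mulVec_smul, Pi.add_apply, Pi.smul_apply, smul_eq_mul]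
    linarith

/-- Translates `half` into the reduced coordinates, with the factor `r ^ 6` split off. The last
identity turns `Admissible.le` into the inequality `hs` of `five_halves_lt_kappa`. -/
lemma half_reduced {r : ℝ} (hr : r ≠ 0) (v : Fin 3 → ℝ) {κ η d β γ b : ℝ}
    (hκ : κ = (1 - r) ^ 2 / (2 * r)) (hη : η = 1 - r * κ / 2) (hd : d = v 0 - v 2)
    (hβ : β = 2 * (alpha r * v 1 - v 0)) (hγ : γ = -2 * v 2)
    (hb : b = 2 * d - κ * β / 2 - η * γ) :
    half r v 0 - half r v 2 = r ^ 6 * ((b + r * β) / 2) ∧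
    -2 * half r v 2 =
      r ^ 6 * (b - κ * ((κ - 1) * b / 2 - (κ + 1) * r * β / 2 - r * γ)) ∧
    2 * (alpha r * half r v 1 - half r v 0) + κ * (-2 * half r v 2) =
      r ^ 6 * (r * (κ * β + γ)) ∧
    2 * ((blockMatrix r 2).mulVec ((blockMatrix r 0).mulVec v) 0 -
      alpha r * (blockMatrix r 2).mulVec ((blockMatrix r 0).mulVec v) 1) =
      r ^ 2 * (κ * (b - r * β) / 2 - r * γ) := by
  subst hb hd hβ hγ hη hκ
  simp only [half, flip, blockMatrix_zero_mulVec, blockMatrix_one_mulVec, blockMatrix_two_mulVec,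
    alpha, Matrix.cons_val_zero, Matrix.cons_val_one, Matrix.cons_val]
  refine ⟨?_, ?_, ?_, ?_⟩ <;> field_simp <;> ring

lemma exists_expanding_functional {r lam : ℝ} (hr0 : 0 < r) (hr1 : r < 1) (hlam : 0 < lam)
    {v : Fin 3 → ℝ} (hv : Admissible r v) (hv' : Admissible r (half r v))
    (h : half r (half r v) = lam • v) :
    ∃ σ > lam, ∃ φ : (Fin 3 → ℝ) →ₗ[ℝ] ℝ, φ ≠ 0 ∧ ∀ u, φ (half r (half r u)) = σ * φ u := by
  obtain ⟨κ, hκ⟩ : ∃ κ, κ = (1 - r) ^ 2 / (2 * r) := ⟨_, rfl⟩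
  obtain ⟨η, hη⟩ : ∃ η, η = 1 - r * κ / 2 := ⟨_, rfl⟩
  have hκ' : 2 * r * κ = (1 - r) ^ 2 := by rw [hκ]; field_simp
  have hr6 : 0 < r ^ 6 := by positivity
  have hsq : √lam * √lam = lam := Real.mul_self_sqrt hlam.le
  have hs0 : 0 < √lam := Real.sqrt_pos.2 hlam
  -- Projects `v` onto the `√lam`-eigenspace of `half`, up to a factor `2`. The positive coefficient
  -- keeps `p` admissible.
  set p := v + (√lam)⁻¹ • half r v with hp
  have hpa : Admissible r p := hv.add_smul hv' (by positivity)
  have hpe : half r p = √lam • p := by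
    rw [hp, half_add_smul, h, smul_add, smul_smul, smul_smul, mul_inv_cancel₀ hs0.ne', one_smul,
      add_comm]
    congr 2
    field_simp
    linarith
  obtain ⟨b, hb⟩ : ∃ b, b = 2 * (p 0 - p 2) - κ * (2 * (alpha r * p 1 - p 0)) / 2
    - η * (-2 * p 2) := ⟨_, rfl⟩
  obtain ⟨h1, h2, h3, h4⟩ := half_reduced hr0.ne' p hκ hη rfl rfl rfl hb
  rw [hpe] at h1 h2 h3
  simp only [Pi.smul_apply, smul_eq_mul] at h1 h2 h3
  have hm : 0 < √lam / r ^ 6 := by positivity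
  have hle := hpa.le
  have hnn := hpa.nonpos
  have hlt := hpa.lt
  have hs : 2 * r * (-2 * p 2) ≤ κ * (b - r * (2 * (alpha r * p 1 - p 0))) := by
    have : 0 ≤ r ^ 2 * (κ * (b - r * (2 * (alpha r * p 1 - p 0))) / 2 - r * (-2 * p 2)) := by
      rw [← h4]; linarith
    have := nonneg_of_mul_nonneg_right this (by positivity)
    linarith
  obtain ⟨t, ht, l₁, l₂, l₃, hl, hφ⟩ := exists_left_eigenvector hr0 hr1 hκ' hη
    (by linarith : 0 < 2 * (alpha r * p 1 - p 0)) (by linarith : 0 ≤ -2 * p 2) hb hs hm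
    (by field_simp; linarith) (by field_simp; linarith) (by field_simp; linarith)
  let φ : (Fin 3 → ℝ) →ₗ[ℝ] ℝ :=
    { toFun := fun u => l₁ * (u 0 - u 2) + l₂ * (2 * (alpha r * u 1 - u 0) + κ * (-2 * u 2)) +
        l₃ * (-2 * u 2)
      map_add' := fun u w => by simp only [Pi.add_apply]; ring
      map_smul' := fun c u => by
        simp only [Pi.smul_apply, smul_eq_mul, RingHom.id_apply]; ring }
  have hφ_apply (u : Fin 3 → ℝ) : φ u = l₁ * (u 0 - u 2) +
    l₂ * (2 * (alpha r * u 1 - u 0) + κ * (-2 * u 2)) + l₃ * (-2 * u 2) := rfl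
  have hhalf (u : Fin 3 → ℝ) : φ (half r u) = t * r ^ 6 * φ u := by
    obtain ⟨g1, g2, g3, -⟩ := half_reduced hr0.ne' u hκ hη rfl rfl rfl rfl
    rw [hφ_apply, hφ_apply, g1, g3, g2]
    have := hφ (u 0 - u 2) (2 * (alpha r * u 1 - u 0)) (-2 * u 2) _ _ _ _ rfl rfl rfl
      (sub_add_cancel _ _)
    rw [sub_add_cancel] at this
    linear_combination r ^ 6 * this
  -- `t` is below `-√lam / r ^ 6`, so squaring gives more than `lam`.
  refine ⟨(t * r ^ 6) ^ 2, ?_, φ, ?_, fun u => ?_⟩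
  · have : √lam < -(t * r ^ 6) := by
      have := mul_lt_mul_of_pos_right ht hr6
      rw [neg_mul, div_mul_cancel₀ _ hr6.ne'] at this
      linarith
    nlinarith
  · intro h0
    have ha : alpha r ≠ 0 := (alpha_pos hr0).ne'
    -- At this vector `d = 1` and `β = γ = 0`, so `φ` takes the value `l₁ ≠ 0`.
    have := hφ_apply ![1, (alpha r)⁻¹, 0]
    simp [h0, ha] at this
    exact hl this.symm
  · rw [hhalf, hhalf]; ring


/-! ### The mapping on unit vectors, and generic orbits -/

/-- The action of a cycle on normal vectors. -/
noncomputable def blockMap (r : ℝ) (s : Fin 3) :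
    EuclideanSpace ℝ (Fin 3) →L[ℝ] EuclideanSpace ℝ (Fin 3) :=
  Matrix.toEuclideanCLM (n := Fin 3) (𝕜 := ℝ) (blockMatrix r s)

lemma ofLp_blockMap (r : ℝ) (s : Fin 3) (v : EuclideanSpace ℝ (Fin 3)) :
    (blockMap r s v).ofLp = (blockMatrix r s).mulVec v.ofLp :=
  Matrix.ofLp_toEuclideanCLM _ _

lemma blockMap_injective {r : ℝ} (hr : 0 < r) (s : Fin 3) :
    Function.Injective (blockMap r s) := by
  intro v w h
  have h' := congrArg WithLp.ofLp h
  rw [ofLp_blockMap, ofLp_blockMap] at h'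
  exact WithLp.ofLp_injective 2 (Matrix.mulVec_injective_of_isUnit
    ((Matrix.isUnit_iff_isUnit_det _).2 (det_blockMatrix_ne_zero hr s).isUnit) h')

lemma blockMap_ne_zero {r : ℝ} (hr : 0 < r) (s : Fin 3) {v : EuclideanSpace ℝ (Fin 3)}
    (hv : v ≠ 0) : blockMap r s v ≠ 0 := by
  rw [← map_zero (blockMap r s)]
  exact (blockMap_injective hr s).ne hv

/-- The unit vectors in the cone of the chosen representatives. -/
def sphereCone : Set (EuclideanSpace ℝ (Fin 3)) := {u | ‖u‖ = 1 ∧ Cone u.ofLp}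

lemma ne_zero_of_mem_sphereCone {u : EuclideanSpace ℝ (Fin 3)} (hu : u ∈ sphereCone) : u ≠ 0 := by
  rintro rfl
  simpa using hu.1

lemma rep_of_cone {u : EuclideanSpace ℝ (Fin 3)} (hu : Cone u.ofLp) : rep u = u.ofLp :=
  if_pos hu

lemma bToB_eq {r : ℝ} (hr : 0 < r) {u : EuclideanSpace ℝ (Fin 3)} (hu : Cone u.ofLp) :
    bToB r u = ‖blockMap r (cycle r u.ofLp) u‖⁻¹ • blockMap r (cycle r u.ofLp) u := by
  have : WithLp.toLp 2 (bBlock r (rep u)).2 = blockMap r (cycle r u.ofLp) u := by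
    rw [rep_of_cone hu, (bBlock_eq hr hu).1, ← ofLp_blockMap]
  simp only [bToB, this]

lemma symbol_eq {r : ℝ} (hr : 0 < r) {u : EuclideanSpace ℝ (Fin 3)} (hu : Cone u.ofLp) :
    symbol r u = (cycle r u.ofLp : ℕ) + 1 := by
  obtain ⟨-, h0, h2⟩ := bBlock_eq hr hu
  simp only [symbol, rep_of_cone hu, h0, h2]
  generalize cycle r u.ofLp = s
  fin_cases s <;> simp

lemma bToB_mem {r : ℝ} (hr : 0 < r) {u : EuclideanSpace ℝ (Fin 3)} (hu : u ∈ sphereCone) :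
    bToB r u ∈ sphereCone := by
  have h := blockMap_ne_zero hr (cycle r u.ofLp) (ne_zero_of_mem_sphereCone hu)
  have hc := hu.2.blockMatrix_mulVec hr
  rw [← ofLp_blockMap] at hc
  rw [bToB_eq hr hu.2]
  refine ⟨norm_smul_inv_norm h, ?_, ?_⟩
  · exact mul_nonneg (by positivity) hc.1
  · exact mul_nonpos_of_nonneg_of_nonpos (by positivity) hc.2

lemma iterate_bToB_mem {r : ℝ} (hr : 0 < r) {u : EuclideanSpace ℝ (Fin 3)} (hu : u ∈ sphereCone)
    (n : ℕ) : (bToB r)^[n] u ∈ sphereCone := by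
  induction n with
  | zero => exact hu
  | succ n ih => rw [Function.iterate_succ_apply']; exact bToB_mem hr ih

/-- The product of the maps of successive cycles. -/
noncomputable def wordMap (r : ℝ) :
    List (Fin 3) → EuclideanSpace ℝ (Fin 3) →L[ℝ] EuclideanSpace ℝ (Fin 3)
  | [] => ContinuousLinearMap.id ℝ _
  | s :: l => (wordMap r l).comp (blockMap r s)

lemma wordMap_cons (r : ℝ) (s : Fin 3) (l : List (Fin 3)) (v : EuclideanSpace ℝ (Fin 3)) :
    wordMap r (s :: l) v = wordMap r l (blockMap r s v) := rfl

lemma wordMap_bijective {r : ℝ} (hr : 0 < r) (l : List (Fin 3)) :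
    Function.Bijective (wordMap r l) := by
  have h : Function.Injective (wordMap r l) := by
    induction l with
    | nil => exact Function.injective_id
    | cons s l ih => exact ih.comp (blockMap_injective hr s)
  exact ⟨h, (LinearMap.injective_iff_surjective (f := (wordMap r l).toLinearMap)).1 h⟩

lemma iterate_bToB_eq_smul {r : ℝ} (hr : 0 < r) (l : List (Fin 3))
    {u : EuclideanSpace ℝ (Fin 3)} (hu : u ∈ sphereCone)
    (h : ∀ k (hk : k < l.length), cycle r ((bToB r)^[k] u).ofLp = l[k]) :
    ∃ c : ℝ, 0 < c ∧ (bToB r)^[l.length] u = c • wordMap r l u := by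
  induction l generalizing u with
  | nil => exact ⟨1, one_pos, by simp [wordMap]⟩
  | cons s l ih =>
    obtain ⟨c, hc, hcu⟩ := ih (bToB_mem hr hu) fun k hk =>
      h (k + 1) (Nat.succ_lt_succ hk)
    have hs : cycle r u.ofLp = s := h 0 (by simp)
    have hne := blockMap_ne_zero hr s (ne_zero_of_mem_sphereCone hu)
    refine ⟨c * ‖blockMap r s u‖⁻¹, by positivity, ?_⟩
    rw [List.length_cons, Function.iterate_succ_apply, hcu, bToB_eq hr hu.2, hs, map_smul,
      smul_smul, wordMap_cons]

lemma exists_iterate_bToB_eq_smul {r : ℝ} (hr : 0 < r) (n : ℕ) {u : EuclideanSpace ℝ (Fin 3)}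
    (hu : u ∈ sphereCone) : ∃ l, ∃ c : ℝ, 0 < c ∧ (bToB r)^[n] u = c • wordMap r l u := by
  obtain ⟨c, hc, h⟩ := iterate_bToB_eq_smul hr
    ((List.range n).map fun k => cycle r ((bToB r)^[k] u).ofLp) hu (by simp)
  exact ⟨_, c, hc, by simpa using h⟩

/-- A nonzero functional does not vanish along the orbits of suitable points close to `u`. -/
lemma exists_generic {r : ℝ} (hr : 0 < r) {u : EuclideanSpace ℝ (Fin 3)} (hu : u ∈ sphereCone)
    {φ : EuclideanSpace ℝ (Fin 3) →L[ℝ] ℝ} (hφ : φ ≠ 0) {δ : ℝ} (hδ : 0 < δ) :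
    ∃ v ∈ sphereCone, 0 < v 0 ∧ dist v u < δ ∧ ∀ n, φ ((bToB r)^[n] v) ≠ 0 := by
  let U : Set (EuclideanSpace ℝ (Fin 3)) :=
    {v | 0 < v 0 ∧ v 2 < 0 ∧ v ≠ 0 ∧ dist (‖v‖⁻¹ • v) u < δ}
  have hu0 := ne_zero_of_mem_sphereCone hu
  have hcont : ∀ v : EuclideanSpace ℝ (Fin 3), v ≠ 0 →
      ContinuousAt (fun v : EuclideanSpace ℝ (Fin 3) => ‖v‖⁻¹ • v) v := fun v hv =>
    (continuousAt_id.norm.inv₀ (norm_ne_zero_iff.2 hv)).smul continuousAt_id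
  have hUo : IsOpen U := by
    rw [isOpen_iff_mem_nhds]
    rintro v ⟨h0, h2, h3, h4⟩
    have c0 : ContinuousAt (fun v : EuclideanSpace ℝ (Fin 3) => v 0) v := by fun_prop
    have c2 : ContinuousAt (fun v : EuclideanSpace ℝ (Fin 3) => v 2) v := by fun_prop
    filter_upwards [c0.eventually_const_lt h0, c2.eventually_lt_const h2,
      isOpen_ne.mem_nhds h3,
      (((hcont v h3).dist continuousAt_const).eventually_lt_const h4)] with w a b c d
    exact ⟨a, b, c, d⟩
  have hUn : U.Nonempty := by
    let e : EuclideanSpace ℝ (Fin 3) := !₂[1, 0, -1]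
    have hline : Filter.Tendsto (fun t : ℝ => u + t • e) (nhdsWithin 0 (Set.Ioi 0)) (nhds u) := by
      have : ContinuousAt (fun t : ℝ => u + t • e) 0 := by fun_prop
      have := this.tendsto
      simp only [zero_smul, add_zero] at this
      exact this.mono_left nhdsWithin_le_nhds
    have h1 : dist (‖u‖⁻¹ • u) u < δ := by rw [hu.1]; simpa using hδ
    have e1 := hline.eventually (isOpen_ne.mem_nhds hu0)
    have e2 := hline.eventually
      (((hcont u hu0).dist continuousAt_const).eventually_lt_const h1)
    obtain ⟨t, ht1, ht2, ht⟩ := (e1.and (e2.and self_mem_nhdsWithin)).exists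
    have ht : 0 < t := ht
    refine ⟨u + t • e, ?_, ?_, ht1, ht2⟩
    · have := hu.2.1
      simp [e]; linarith
    · have := hu.2.2
      simp [e]; linarith
  -- Every iterate of a point is a positive multiple of its image under some word. There are
  -- countably many words, each acting invertibly, so Baire avoids all the kernels at once.
  have hdense : Dense (⋂ l : List (Fin 3), {v | φ (wordMap r l v) ≠ 0}) := by
    refine dense_iInter_of_isOpen (fun l => ?_) (fun l => ?_)
    · exact isOpen_ne_fun (by fun_prop) continuous_const
    · have hsurj : Function.Surjective (φ.comp (wordMap r l)) := by
        have : Function.Surjective φ := by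
          have := LinearMap.surjective (f := φ.toLinearMap)
            fun h => hφ (ContinuousLinearMap.coe_injective h)
          exact this
        exact this.comp (wordMap_bijective hr l).2
      exact (dense_compl_singleton (0 : ℝ)).preimage
        ((φ.comp (wordMap r l)).isOpenMap hsurj)
  obtain ⟨v, ⟨h0, h2, h3, h4⟩, hv⟩ := hdense.inter_open_nonempty U hUo hUn
  have hn : 0 < ‖v‖⁻¹ := inv_pos.2 (norm_pos_iff.2 h3)
  have hmem : ‖v‖⁻¹ • v ∈ sphereCone :=
    ⟨norm_smul_inv_norm h3, (mul_pos hn h0).le, (mul_neg_of_pos_of_neg hn h2).le⟩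
  refine ⟨‖v‖⁻¹ • v, hmem, mul_pos hn h0, h4, fun n => ?_⟩
  obtain ⟨l, c, hc, h⟩ := exists_iterate_bToB_eq_smul hr n hmem
  rw [h, map_smul, map_smul, map_smul]
  have := Set.mem_iInter.1 hv l
  exact smul_ne_zero hc.ne' (smul_ne_zero hn.ne' this)


/-! ### Triple collisions -/

lemma lt_alpha_sq {r : ℝ} (hr1 : r < 1) : r < alpha r ^ 2 := by
  have : 0 < (1 - r) ^ 2 := pow_pos (by linarith) 2
  unfold alpha
  linarith

/-- No degenerate triple collision occurs in the cycle that starts at `w`. -/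
def Regular (w : Fin 3 → ℝ) : Prop := w 1 ≠ 0 ∨ (w 0 ≠ 0 ∧ w 2 ≠ 0)

lemma cycle_eq_zero_iff {r : ℝ} {w : Fin 3 → ℝ} : cycle r w = 0 ↔ w 0 < alpha r * w 1 := by
  unfold cycle; split_ifs <;> simp_all

lemma cycle_eq_one_iff {r : ℝ} {w : Fin 3 → ℝ} :
    cycle r w = 1 ↔ alpha r * w 1 ≤ w 0 ∧ w 2 ≤ alpha r * w 1 := by
  unfold cycle; split_ifs <;> simp_all

lemma cycle_eq_two_iff {r : ℝ} {w : Fin 3 → ℝ} (hw : Cone w) :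
    cycle r w = 2 ↔ alpha r * w 1 < w 2 := by
  have h0 := hw.1
  have h2 := hw.2
  unfold cycle
  split_ifs <;> simp_all
  linarith

/-- Because `r < α²`, a degenerate `w` would be followed by a cycle other than 2. If the image is
degenerate, comparing signs on the cone gives `w = 0`. -/
lemma regular_of_cycle_blockMatrix_eq_one {r : ℝ} (hr0 : 0 < r) (hr1 : r < 1) {w : Fin 3 → ℝ} (hw : Cone w)
    (hw0 : w ≠ 0) (h' : cycle r ((blockMatrix r 1).mulVec w) = 1) :
    Regular w ∧ Regular ((blockMatrix r 1).mulVec w) := by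
  have ha := alpha_pos hr0
  have hra := lt_alpha_sq hr1
  obtain ⟨h0, h2⟩ := hw
  have hne : w 0 = 0 → w 1 = 0 → w 2 = 0 → False := by
    intro a b c
    apply hw0
    ext i
    fin_cases i <;> simpa
  rw [cycle_eq_one_iff] at h'
  rw [blockMatrix_one_mulVec] at h' ⊢
  simp only [Matrix.cons_val_zero, Matrix.cons_val_one, Matrix.cons_val] at h'
  constructor
  · by_contra hcon
    simp only [Regular, not_or, not_and_or, not_not] at hcon
    obtain ⟨hy, hx | hz⟩ := hcon
    · rw [hx, hy] at h'
      have : 0 ≤ r * (alpha r ^ 2 - r) * w 2 := by linarith [h'.2]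
      have := nonneg_of_mul_nonneg_right this (mul_pos hr0 (by linarith))
      exact hne hx hy (le_antisymm h2 this)
    · rw [hz, hy] at h'
      have : 0 ≤ r * (alpha r ^ 2 - r) * (-w 0) := by linarith [h'.1]
      have := nonneg_of_mul_nonneg_right this (mul_pos hr0 (by linarith))
      exact hne (by linarith) hy hz
  · by_contra hcon
    simp only [Regular, not_or, not_and_or, not_not, Matrix.cons_val_zero, Matrix.cons_val_one,
      Matrix.cons_val] at hcon
    obtain ⟨hy, hx | hz⟩ := hcon
    · have hx' := (mul_eq_zero.1 hx).resolve_left (by positivity)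
      have hy0 : 0 ≤ w 1 := nonneg_of_mul_nonneg_right (by linarith : 0 ≤ alpha r * w 1) ha
      have e : r * (alpha r * w 2) = r * ((alpha r ^ 2 - r) * w 1) := by
        linear_combination hy - r * alpha r * hx'
      have e := mul_left_cancel₀ hr0.ne' e
      have hz : alpha r * w 2 ≤ 0 := mul_nonpos_of_nonneg_of_nonpos ha.le h2
      have hy1 : w 1 = 0 := by
        refine le_antisymm ?_ hy0
        by_contra hlt
        have := mul_pos (sub_pos.2 hra) (not_le.1 hlt)
        linarith
      rw [hy1] at e hx'
      refine hne (by linarith) hy1 ?_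
      rw [mul_zero] at e
      exact (mul_eq_zero.1 e).resolve_left ha.ne'
    · have hx' := (mul_eq_zero.1 hz).resolve_left (by positivity)
      have hy0 : 0 ≤ -w 1 :=
        nonneg_of_mul_nonneg_right (by linarith : 0 ≤ alpha r * (-w 1)) ha
      have e : r * (alpha r * w 0) = r * ((alpha r ^ 2 - r) * w 1) := by
        linear_combination hy - r * alpha r * hx'
      have e := mul_left_cancel₀ hr0.ne' e
      have hz : 0 ≤ alpha r * w 0 := mul_nonneg ha.le h0
      have hy1 : w 1 = 0 := by
        refine le_antisymm ?_ (by linarith) |>.symm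
        by_contra hlt
        have := mul_pos (sub_pos.2 hra) (show 0 < -w 1 by linarith)
        linarith
      rw [hy1] at e hx'
      rw [mul_zero] at e
      exact hne ((mul_eq_zero.1 e).resolve_left ha.ne') hy1 (by linarith)

/-- At a regular triple collision, the image of the plane under the cycle acb differs from the
images under the two shorter cycles. -/
lemma blockMap_not_parallel {r : ℝ} (hr0 : 0 < r) {w : EuclideanSpace ℝ (Fin 3)}
    (hw : Cone w.ofLp) (hreg : Regular w.ofLp) {s : Fin 3}
    (hs : s = 0 ∧ alpha r * w 1 = w 0 ∨ s = 2 ∧ alpha r * w 1 = w 2) {a b : ℝ} (ha : a ≠ 0)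
    (hb : b ≠ 0) : a • blockMap r s w ≠ b • blockMap r 1 w := by
  intro h
  have h := congrArg WithLp.ofLp h
  simp only [WithLp.ofLp_smul, ofLp_blockMap] at h
  have h0 := congrFun h 0
  have h1 := congrFun h 1
  have h2 := congrFun h 2
  obtain ⟨c0, c2⟩ := hw
  have hal := alpha_pos hr0
  obtain ⟨rfl, he⟩ | ⟨rfl, he⟩ := hs
  · simp only [blockMatrix_zero_mulVec, blockMatrix_one_mulVec, Pi.smul_apply, smul_eq_mul,
      Matrix.cons_val_zero, Matrix.cons_val_one, Matrix.cons_val] at h0 h1 h2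
    have hy : w 1 ≠ 0 := by
      rcases hreg with h | h
      · exact h
      · intro h'; rw [h', mul_zero] at he; exact h.1 he.symm
    rw [← he] at h1
    have key : a * b * r ^ 3 * w 1 * (alpha r * w 1 - (1 + r) * w 2) = 0 := by
      linear_combination (b * (r ^ 2 * (w 2 - alpha r * w 1))) * h1 -
        (b * (r ^ 2 * w 1 + r * alpha r * (alpha r * w 1 + w 2 - 2 * (alpha r * w 1)))) * h2
    have key := (mul_eq_zero.1 key).resolve_left (by positivity)
    have : (1 + r) * w 2 ≤ 0 := mul_nonpos_of_nonneg_of_nonpos (by positivity) c2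
    exact mul_ne_zero hal.ne' hy (by linarith)
  · simp only [blockMatrix_two_mulVec, blockMatrix_one_mulVec, Pi.smul_apply, smul_eq_mul,
      Matrix.cons_val_zero, Matrix.cons_val_one, Matrix.cons_val] at h0 h1 h2
    have hy : w 1 ≠ 0 := by
      rcases hreg with h | h
      · exact h
      · intro h'; rw [h', mul_zero] at he; exact h.2 he.symm
    rw [← he] at h1
    have key : a * b * r ^ 3 * w 1 * (alpha r * w 1 - (1 + r) * w 0) = 0 := by
      linear_combination (b * (r ^ 2 * (w 0 - alpha r * w 1))) * h1 -
        (b * (r ^ 2 * w 1 + r * alpha r * (w 0 + alpha r * w 1 - 2 * (alpha r * w 1)))) * h0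
    have key := (mul_eq_zero.1 key).resolve_left (by positivity)
    have : 0 ≤ (1 + r) * w 0 := mul_nonneg (by positivity) c0
    exact mul_ne_zero hal.ne' hy (by linarith)

/-- Cycles 1 and 3 are given by strict inequalities, hence persist nearby. Cycle 2 may fail to
persist at a triple collision; there a neighbour with a shorter cycle has an image far from that of
`w`, which is why closeness of the images is also assumed. -/
lemma exists_dist_lt_cycle_eq {r : ℝ} (hr0 : 0 < r) {w : EuclideanSpace ℝ (Fin 3)}
    (hw : w ∈ sphereCone) (hreg : cycle r w.ofLp = 1 → Regular w.ofLp) :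
    ∃ ε > 0, ∀ v ∈ sphereCone, dist v w < ε → dist (bToB r v) (bToB r w) < ε →
      cycle r v.ofLp = cycle r w.ofLp := by
  have hcont (i : Fin 3) : ContinuousAt (fun v : EuclideanSpace ℝ (Fin 3) => v i) w := by fun_prop
  have hcont' : ContinuousAt (fun v : EuclideanSpace ℝ (Fin 3) => alpha r * v 1) w := by fun_prop
  have hw0 := ne_zero_of_mem_sphereCone hw
  have hsep (s : Fin 3) (hs : s = 0 ∧ alpha r * w 1 = w 0 ∨ s = 2 ∧ alpha r * w 1 = w 2)
      (h1 : cycle r w.ofLp = 1) : ∃ ε > 0, ∀ v ∈ sphereCone, dist v w < ε →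
        dist (bToB r v) (bToB r w) < ε → cycle r v.ofLp ≠ s := by
    let N : EuclideanSpace ℝ (Fin 3) → EuclideanSpace ℝ (Fin 3) :=
      fun v => ‖blockMap r s v‖⁻¹ • blockMap r s v
    have hN : ContinuousAt N w :=
      ((blockMap r s).continuous.continuousAt.norm.inv₀
        (norm_ne_zero_iff.2 (blockMap_ne_zero hr0 s hw0))).smul
        (blockMap r s).continuous.continuousAt
    have hd : 0 < dist (N w) (bToB r w) := by
      rw [dist_pos, bToB_eq hr0 hw.2, h1]
      exact blockMap_not_parallel hr0 hw.2 (hreg h1) hs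
        (inv_ne_zero (norm_ne_zero_iff.2 (blockMap_ne_zero hr0 s hw0)))
        (inv_ne_zero (norm_ne_zero_iff.2 (blockMap_ne_zero hr0 1 hw0)))
    obtain ⟨δ, hδ, h⟩ := Metric.continuousAt_iff.1 hN _ (half_pos hd)
    refine ⟨min δ (dist (N w) (bToB r w) / 2), lt_min hδ (half_pos hd), fun v hv h2 h3 h4 => ?_⟩
    have h5 := h (h2.trans_le (min_le_left _ _))
    have h6 := h3.trans_le (min_le_right _ _)
    rw [bToB_eq hr0 hv.2, h4] at h6
    have := dist_triangle_left (N w) (bToB r w) (N v)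
    simp only [N] at this h5 h6 hd
    linarith
  have hopen (s : Fin 3) (h : ∀ᶠ v in nhds w, v ∈ sphereCone → cycle r v.ofLp ≠ s) :
      ∃ ε > 0, ∀ v ∈ sphereCone, dist v w < ε →
        dist (bToB r v) (bToB r w) < ε → cycle r v.ofLp ≠ s := by
    obtain ⟨ε, hε, h⟩ := Metric.eventually_nhds_iff.1 h
    exact ⟨ε, hε, fun v hv h1 _ => h h1 hv⟩
  have hall (s : Fin 3) (hs : s ≠ cycle r w.ofLp) : ∃ ε > 0, ∀ v ∈ sphereCone, dist v w < ε →
        dist (bToB r v) (bToB r w) < ε → cycle r v.ofLp ≠ s := by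
    have h3 : cycle r w.ofLp = 0 ∨ cycle r w.ofLp = 1 ∨ cycle r w.ofLp = 2 := by
      generalize cycle r w.ofLp = t; fin_cases t <;> simp
    rcases h3 with h | h | h
    · apply hopen
      filter_upwards [(hcont 0).eventually_lt hcont' (cycle_eq_zero_iff.1 h)] with v hv _ h'
      rw [cycle_eq_zero_iff.2 hv] at h'
      exact hs (h'.symm.trans h.symm)
    · have hle := cycle_eq_one_iff.1 h
      have hs2 : s = 0 ∨ s = 2 := by
        rw [h] at hs; fin_cases s <;> simp_all
      rcases hs2 with rfl | rfl
      · rcases hle.1.eq_or_lt with h' | h'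
        · exact hsep 0 (.inl ⟨rfl, h'⟩) h
        · apply hopen
          filter_upwards [hcont'.eventually_lt (hcont 0) h'] with v hv _ hc
          exact hv.not_gt (cycle_eq_zero_iff.1 hc)
      · rcases hle.2.eq_or_lt with h' | h'
        · exact hsep 2 (.inr ⟨rfl, h'.symm⟩) h
        · apply hopen
          filter_upwards [(hcont 2).eventually_lt hcont' h'] with v hv hm hc
          exact hv.not_gt ((cycle_eq_two_iff hm.2).1 hc)
    · apply hopen
      filter_upwards [hcont'.eventually_lt (hcont 2) ((cycle_eq_two_iff hw.2).1 h)] with v hv hm h'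
      rw [(cycle_eq_two_iff hm.2).2 hv] at h'
      exact hs (h'.symm.trans h.symm)
  have hall' (s : Fin 3) : ∃ ε > 0, ∀ v ∈ sphereCone, dist v w < ε →
      dist (bToB r v) (bToB r w) < ε → s ≠ cycle r w.ofLp → cycle r v.ofLp ≠ s := by
    by_cases hs : s = cycle r w.ofLp
    · exact ⟨1, one_pos, fun _ _ _ _ h => absurd hs h⟩
    · obtain ⟨ε, hε, h⟩ := hall s hs
      exact ⟨ε, hε, fun v hv h1 h2 _ => h v hv h1 h2⟩
  choose ε hε h using hall'
  refine ⟨min (ε 0) (min (ε 1) (ε 2)), lt_min (hε 0) (lt_min (hε 1) (hε 2)),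
    fun v hv h1 h2 => ?_⟩
  simp only [lt_min_iff] at h1 h2
  by_contra hne
  have h3 : cycle r v.ofLp = 0 ∨ cycle r v.ofLp = 1 ∨ cycle r v.ofLp = 2 := by
    generalize cycle r v.ofLp = t; fin_cases t <;> simp
  rcases h3 with e | e | e
  · exact h 0 v hv h1.1 h2.1 (e ▸ hne) e
  · exact h 1 v hv h1.2.1 h2.2.1 (e ▸ hne) e
  · exact h 2 v hv h1.2.2 h2.2.2 (e ▸ hne) e


/-! ### Escape from the periodic orbit -/

/-- The cycles of the periodic orbit with the symbols 1, 3, 2, 2, 3, 1, 2, 2. -/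
def pattern : List (Fin 3) := [0, 2, 1, 1, 2, 0, 1, 1]

lemma ofLp_wordMap_pattern (r : ℝ) (v : EuclideanSpace ℝ (Fin 3)) :
    (wordMap r pattern v).ofLp = half r (half r v.ofLp) := by
  rw [half_half]
  simp only [pattern, wordMap, ContinuousLinearMap.comp_apply, ContinuousLinearMap.id_apply,
    ofLp_blockMap]

lemma cycle_wordMap {r : ℝ} (hr : 0 < r) {l₁ : List (Fin 3)} {s : Fin 3} {l₂ : List (Fin 3)}
    {u : EuclideanSpace ℝ (Fin 3)} (hu : u ∈ sphereCone)
    (h : ∀ k (hk : k < (l₁ ++ s :: l₂).length),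
      cycle r ((bToB r)^[k] u).ofLp = (l₁ ++ s :: l₂)[k]) :
    cycle r (wordMap r l₁ u).ofLp = s ∧ Cone (wordMap r l₁ u).ofLp := by
  obtain ⟨c, hc, hcu⟩ := iterate_bToB_eq_smul hr l₁ hu fun k hk => by
    rw [h k (by simp; omega), List.getElem_append_left hk]
  have h1 := h l₁.length (by simp)
  have h2 := (iterate_bToB_mem hr hu l₁.length).2
  rw [hcu, WithLp.ofLp_smul] at h1 h2
  rw [cycle_smul r hc] at h1
  refine ⟨by simpa using h1, ?_, ?_⟩
  · exact nonneg_of_mul_nonneg_right h2.1 hc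
  · exact nonpos_of_mul_nonpos_right h2.2 hc

/-- The inequalities for `half r u` are those of the second half 3122, reflected. -/
lemma admissible_of_pattern {r : ℝ} (hr : 0 < r) {u : EuclideanSpace ℝ (Fin 3)}
    (hu : u ∈ sphereCone)
    (h : ∀ k (hk : k < pattern.length), cycle r ((bToB r)^[k] u).ofLp = pattern[k]) :
    Admissible r u.ofLp ∧ Admissible r (half r u.ofLp) := by
  have c0 := cycle_wordMap hr (l₁ := []) (s := 0) (l₂ := [2, 1, 1, 2, 0, 1, 1]) hu h
  have c2 := cycle_wordMap hr (l₁ := [0, 2]) (s := 1) (l₂ := [1, 2, 0, 1, 1]) hu h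
  have c4 := cycle_wordMap hr (l₁ := [0, 2, 1, 1]) (s := 2) (l₂ := [0, 1, 1]) hu h
  have c6 := cycle_wordMap hr (l₁ := [0, 2, 1, 1, 2, 0]) (s := 1) (l₂ := [1]) hu h
  simp only [wordMap, ContinuousLinearMap.comp_apply, ContinuousLinearMap.id_apply,
    ofLp_blockMap] at c0 c2 c4 c6
  refine ⟨⟨hu.2.2, cycle_eq_zero_iff.1 c0.1, (cycle_eq_one_iff.1 c2.1).1⟩, ?_⟩
  have g4 := (cycle_eq_two_iff c4.2).1 c4.1
  have g6 := (cycle_eq_one_iff.1 c6.1).2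
  have h0 : Fin.rev (0 : Fin 3) = 2 := rfl
  have h2 : Fin.rev (2 : Fin 3) = 0 := rfl
  have e : (blockMatrix r 2).mulVec ((blockMatrix r 0).mulVec (half r u.ofLp)) =
      flip ((blockMatrix r 0).mulVec ((blockMatrix r 2).mulVec (flip (half r u.ofLp)))) := by
    rw [flip_blockMatrix_mulVec, flip_blockMatrix_mulVec, flip_flip, h0, h2]
  refine ⟨c4.2.flip.2, ?_, ?_⟩
  · simp only [half, flip, Matrix.cons_val_zero, Matrix.cons_val_one]
    linarith
  · rw [e]
    unfold half
    rw [flip_flip]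
    simp only [flip, Matrix.cons_val_zero, Matrix.cons_val_one]
    linarith

lemma regular_pair {r : ℝ} (hr0 : 0 < r) (hr1 : r < 1) {w : EuclideanSpace ℝ (Fin 3)}
    (hw : w ∈ sphereCone) (h : cycle r w.ofLp = 1) (h' : cycle r (bToB r w).ofLp = 1) :
    Regular w.ofLp ∧ Regular (bToB r w).ofLp := by
  have hne := blockMap_ne_zero hr0 1 (ne_zero_of_mem_sphereCone hw)
  have hc : 0 < ‖blockMap r 1 w‖⁻¹ := inv_pos.2 (norm_pos_iff.2 hne)
  rw [bToB_eq hr0 hw.2, h, WithLp.ofLp_smul, ofLp_blockMap] at h' ⊢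
  rw [cycle_smul r hc] at h'
  obtain ⟨h1, h2⟩ := regular_of_cycle_blockMatrix_eq_one hr0 hr1 hw.2
    (fun h0 => ne_zero_of_mem_sphereCone hw (WithLp.ofLp_injective 2 h0)) h'
  refine ⟨h1, ?_⟩
  simpa [Regular, hc.ne', hne] using h2

lemma exists_uniform {P : ℕ → ℝ → Prop} (hP : ∀ j ε ε', ε ≤ ε' → P j ε' → P j ε) (N : ℕ)
    (h : ∀ j < N, ∃ ε > 0, P j ε) : ∃ ε > 0, ∀ j < N, P j ε := by
  induction N with
  | zero => exact ⟨1, one_pos, fun j hj => absurd hj (Nat.not_lt_zero j)⟩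
  | succ N ih =>
    obtain ⟨ε, hε, h1⟩ := ih fun j hj => h j (hj.trans N.lt_succ_self)
    obtain ⟨ε', hε', h2⟩ := h N N.lt_succ_self
    refine ⟨min ε ε', lt_min hε hε', fun j hj => ?_⟩
    rcases Nat.lt_succ_iff_lt_or_eq.1 hj with hj | rfl
    · exact hP _ _ _ (min_le_left _ _) (h1 j hj)
    · exact hP _ _ _ (min_le_right _ _) h2

/-- The orbits that remain close to the periodic orbit undergo the same collisions. -/
lemma exists_dist_lt_follows {r : ℝ} (hr0 : 0 < r) (hr1 : r < 1) {u : EuclideanSpace ℝ (Fin 3)}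
    (hu : u ∈ sphereCone)
    (h : ∀ k (hk : k < pattern.length), cycle r ((bToB r)^[k] u).ofLp = pattern[k]) :
    ∃ ε > 0, ∀ v ∈ sphereCone, (∀ j, dist ((bToB r)^[j] v) ((bToB r)^[j] u) < ε) →
      ∀ k (hk : k < pattern.length), cycle r ((bToB r)^[k] v).ofLp = pattern[k] := by
  have hreg : ∀ j < 8, cycle r ((bToB r)^[j] u).ofLp = 1 → Regular ((bToB r)^[j] u).ofLp := by
    have g0 := h 0 (by simp [pattern])
    have g1 := h 1 (by simp [pattern])
    have g2 := h 2 (by simp [pattern])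
    have g3 := h 3 (by simp [pattern])
    have g4 := h 4 (by simp [pattern])
    have g5 := h 5 (by simp [pattern])
    have g6 := h 6 (by simp [pattern])
    have g7 := h 7 (by simp [pattern])
    -- In the pattern the symbol 2 occurs only in the adjacent pairs at positions 2, 3 and 6, 7.
    have p2 := regular_pair hr0 hr1 (iterate_bToB_mem hr0 hu 2) g2
      (by rw [← Function.iterate_succ_apply' (bToB r)]; exact g3)
    have p6 := regular_pair hr0 hr1 (iterate_bToB_mem hr0 hu 6) g6
      (by rw [← Function.iterate_succ_apply' (bToB r)]; exact g7)
    rw [← Function.iterate_succ_apply' (bToB r)] at p2 p6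
    intro j hj hc
    interval_cases j
    · rw [g0] at hc; exact absurd hc (by decide)
    · rw [g1] at hc; exact absurd hc (by decide)
    · exact p2.1
    · exact p2.2
    · rw [g4] at hc; exact absurd hc (by decide)
    · rw [g5] at hc; exact absurd hc (by decide)
    · exact p6.1
    · exact p6.2
  obtain ⟨ε, hε, hε'⟩ := exists_uniform
    (P := fun j ε => ∀ v ∈ sphereCone, dist v ((bToB r)^[j] u) < ε →
      dist (bToB r v) (bToB r ((bToB r)^[j] u)) < ε →
      cycle r v.ofLp = cycle r ((bToB r)^[j] u).ofLp)
    (fun j ε ε' hle hP v hv h1 h2 => hP v hv (h1.trans_le hle) (h2.trans_le hle)) 8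
    fun j hj => exists_dist_lt_cycle_eq hr0 (iterate_bToB_mem hr0 hu j) (hreg j hj)
  refine ⟨ε, hε, fun v hv hd k hk => ?_⟩
  rw [← h k hk]
  refine hε' k (by simpa [pattern] using hk) _ (iterate_bToB_mem hr0 hv k) (hd k) ?_
  rw [← Function.iterate_succ_apply' (bToB r), ← Function.iterate_succ_apply' (bToB r)]
  exact hd (k + 1)

/-- The orbits on which an expanding functional does not vanish do not remain close to the
periodic orbit. -/
lemma not_eventually_dist_lt {r : ℝ} (hr0 : 0 < r) (hr1 : r < 1) {u : EuclideanSpace ℝ (Fin 3)}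
    (hu : u ∈ sphereCone)
    (h : ∀ k (hk : k < pattern.length), cycle r ((bToB r)^[k] u).ofLp = pattern[k])
    (hper : (bToB r)^[8] u = u) {lam σ : ℝ} (hlam : 0 < lam)
    (hL : wordMap r pattern u = lam • u) (hσ : lam < σ)
    {φ : EuclideanSpace ℝ (Fin 3) →L[ℝ] ℝ}
    (hφ : ∀ x, φ (wordMap r pattern x) = σ * φ x) :
    ∃ ε > 0, ∀ v ∈ sphereCone, (∀ n, φ ((bToB r)^[n] v) ≠ 0) →
      ¬ ∃ K, ∀ n ≥ K, dist ((bToB r)^[n] v) ((bToB r)^[n] u) < ε := by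
  obtain ⟨ε₁, hε₁, hfollow⟩ := exists_dist_lt_follows hr0 hr1 hu h
  set L := wordMap r pattern with hLdef
  -- Near `u` the norm of `L x` stays below `ρ`, so normalising divides by less than `ρ` while `φ`
  -- gains the factor `σ > ρ`.
  obtain ⟨ρ, hρ1, hρ2⟩ := exists_between hσ
  have hρ0 : 0 < ρ := hlam.trans hρ1
  have hLu : ‖L u‖ < ρ := by
    rw [hL, norm_smul, hu.1, mul_one, Real.norm_of_nonneg hlam.le]; exact hρ1
  obtain ⟨ε₂, hε₂, hnorm⟩ := Metric.eventually_nhds_iff.1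
    (L.continuous.norm.continuousAt.eventually_lt_const hLu)
  refine ⟨min ε₁ ε₂, lt_min hε₁ hε₂, fun v hv hne ⟨K, hK⟩ => ?_⟩
  have hperk (k j : ℕ) : (bToB r)^[8 * k + j] u = (bToB r)^[j] u := by
    rw [add_comm, Function.iterate_add_apply, Function.iterate_mul,
      Function.iterate_fixed hper]
  let x : ℕ → EuclideanSpace ℝ (Fin 3) := fun k => (bToB r)^[8 * (K + k)] v
  have hxmem (k : ℕ) : x k ∈ sphereCone := iterate_bToB_mem hr0 hv _
  have hxd (k j : ℕ) : dist ((bToB r)^[j] (x k)) ((bToB r)^[j] u) < min ε₁ ε₂ := by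
    have := hK (8 * (K + k) + j) (by omega)
    rwa [hperk, add_comm, Function.iterate_add_apply] at this
  have hstep (k : ℕ) : σ / ρ * |φ (x k)| ≤ |φ (x (k + 1))| := by
    obtain ⟨c, hc, hcx⟩ := iterate_bToB_eq_smul hr0 pattern (hxmem k)
      (hfollow _ (hxmem k) fun j => (hxd k j).trans_le (min_le_left _ _))
    have hx1 : x (k + 1) = c • L (x k) := by
      rw [← hcx]
      change (bToB r)^[8 * (K + (k + 1))] v = (bToB r)^[8] ((bToB r)^[8 * (K + k)] v)
      rw [← Function.iterate_add_apply]
      congr 2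
      ring
    have hcn : c * ‖L (x k)‖ = 1 := by
      have := (hxmem (k + 1)).1
      rwa [hx1, norm_smul, Real.norm_of_nonneg hc.le] at this
    have hlt : ‖L (x k)‖ < ρ := hnorm ((hxd k 0).trans_le (min_le_right _ _))
    have hcρ : 1 / ρ ≤ c := by
      rw [div_le_iff₀ hρ0, ← hcn]
      gcongr
    rw [hx1, map_smul, hφ, smul_eq_mul, abs_mul, abs_mul, abs_of_pos hc,
      abs_of_pos (hlam.trans hσ), ← mul_assoc]
    gcongr
    calc σ / ρ = 1 / ρ * σ := by ring
      _ ≤ c * σ := by gcongr; exact (hlam.trans hσ).le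
  have hgrow (k : ℕ) : (σ / ρ) ^ k * |φ (x 0)| ≤ |φ (x k)| := by
    induction k with
    | zero => simp
    | succ k ih =>
      have : 0 < σ / ρ := div_pos (hlam.trans hσ) hρ0
      calc (σ / ρ) ^ (k + 1) * |φ (x 0)| = σ / ρ * ((σ / ρ) ^ k * |φ (x 0)|) := by ring
        _ ≤ σ / ρ * |φ (x k)| := by gcongr
        _ ≤ _ := hstep k
  have hpos : 0 < |φ (x 0)| := abs_pos.2 (hne _)
  obtain ⟨k, hk⟩ := pow_unbounded_of_one_lt (‖φ‖ / |φ (x 0)|) ((one_lt_div hρ0).2 hρ2)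
  rw [div_lt_iff₀ hpos] at hk
  have := φ.le_opNorm (x k)
  rw [(hxmem k).1, mul_one, Real.norm_eq_abs] at this
  linarith [hgrow k]

/-- The periodic orbit is unstable, within the chosen representatives. -/
lemma exists_escaping {r : ℝ} (hr0 : 0 < r) (hr1 : r < 1) {u : EuclideanSpace ℝ (Fin 3)}
    (hu : u ∈ sphereCone)
    (h : ∀ k (hk : k < pattern.length), cycle r ((bToB r)^[k] u).ofLp = pattern[k])
    (hper : (bToB r)^[8] u = u) :
    ∃ ε > 0, ∀ δ > 0, ∃ v ∈ sphereCone, 0 < v 0 ∧ dist v u < δ ∧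
      ¬ ∃ K, ∀ n ≥ K, dist ((bToB r)^[n] v) ((bToB r)^[n] u) < ε := by
  obtain ⟨c, hc, hcu⟩ := iterate_bToB_eq_smul hr0 pattern hu h
  have hL : wordMap r pattern u = c⁻¹ • u := by
    have : u = c • wordMap r pattern u := hper.symm.trans hcu
    nth_rewrite 2 [this]
    rw [smul_smul, inv_mul_cancel₀ hc.ne', one_smul]
  obtain ⟨ha, ha'⟩ := admissible_of_pattern hr0 hu h
  obtain ⟨σ, hσ, φ, hφ0, hφ⟩ := exists_expanding_functional hr0 hr1 (inv_pos.2 hc) ha ha'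
    (by rw [← ofLp_wordMap_pattern, hL, WithLp.ofLp_smul])
  let ψ : EuclideanSpace ℝ (Fin 3) →L[ℝ] ℝ :=
    LinearMap.toContinuousLinearMap (φ ∘ₗ (WithLp.linearEquiv 2 ℝ (Fin 3 → ℝ)).toLinearMap)
  have hψ_apply (x : EuclideanSpace ℝ (Fin 3)) : ψ x = φ x.ofLp := rfl
  have hψ0 : ψ ≠ 0 := by
    intro h0
    apply hφ0
    refine LinearMap.ext fun x => ?_
    have := hψ_apply (WithLp.toLp 2 x)
    rw [h0] at this
    simpa using this.symm
  obtain ⟨ε, hε, hesc⟩ := not_eventually_dist_lt hr0 hr1 hu h hper (inv_pos.2 hc) hL hσ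
    (φ := ψ) fun x => by rw [hψ_apply, hψ_apply, ofLp_wordMap_pattern, hφ]
  refine ⟨ε, hε, fun δ hδ => ?_⟩
  obtain ⟨v, hv, hv0, hvd, hvn⟩ := exists_generic hr0 hu hψ0 hδ
  exact ⟨v, hv, hv0, hvd, hesc v hv hvn⟩

/-! ### Representatives: passing between `u` and `-u` -/

/-- A plane that is orthogonal to the second axis does not generate the pattern. -/
lemma not_pattern_of_axis {r : ℝ} (hr : 0 < r) {v : Fin 3 → ℝ} (h0 : v 0 = 0) (h2 : v 2 = 0)
    (hc : cycle r v = 0) (hcone : Cone ((blockMatrix r 0).mulVec v))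
    (hc' : cycle r ((blockMatrix r 0).mulVec v) = 2) : False := by
  have ha := alpha_pos hr
  rw [cycle_eq_zero_iff, h0] at hc
  rw [cycle_eq_two_iff hcone, blockMatrix_zero_mulVec] at hc'
  simp only [h0, h2, Matrix.cons_val_zero, Matrix.cons_val_one, Matrix.cons_val] at hc'
  have hy : 0 < v 1 := pos_of_mul_pos_right hc ha.le
  have e : alpha r ^ 2 - r = (1 - r) ^ 2 / 4 := by unfold alpha; ring
  have : 0 ≤ alpha r * ((alpha r ^ 2 - r) * v 1) := by rw [e]; positivity
  linarith

lemma eventually_dist_lt_of_stable {r : ℝ} {u : EuclideanSpace ℝ (Fin 3)}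
    (h : LyapunovStable r u ∨ LocallyAttracting r u) {ε : ℝ} (hε : 0 < ε) :
    ∃ δ > 0, ∀ v ∈ X, dist v u < δ →
      ∃ K, ∀ n ≥ K, dist ((bToB r)^[n] v) ((bToB r)^[n] u) < ε := by
  rcases h with h | ⟨δ, hδ, h⟩
  · obtain ⟨δ, hδ, h⟩ := h ε hε
    exact ⟨δ, hδ, fun v hv hd => ⟨0, fun n _ => h v hv hd n⟩⟩
  · exact ⟨δ, hδ, fun v hv hd =>
      Filter.eventually_atTop.1 ((h v hv hd).eventually_lt_const hε)⟩

lemma mem_X_of_mem_sphereCone {u : EuclideanSpace ℝ (Fin 3)} (hu : u ∈ sphereCone) : u ∈ X :=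
  ⟨hu.1, .inl hu.2⟩

lemma neg_mem_X_of_mem_sphereCone {u : EuclideanSpace ℝ (Fin 3)} (hu : u ∈ sphereCone) :
    -u ∈ X :=
  ⟨by rw [norm_neg]; exact hu.1, .inr ⟨neg_nonpos.2 hu.2.1, neg_nonneg.2 hu.2.2⟩⟩

lemma bToB_congr_rep {r : ℝ} {u v : EuclideanSpace ℝ (Fin 3)} (h : rep u = rep v) :
    bToB r u = bToB r v := by
  simp only [bToB, h]

lemma symbol_congr_rep {r : ℝ} {u v : EuclideanSpace ℝ (Fin 3)} (h : rep u = rep v) :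
    symbol r u = symbol r v := by
  simp only [symbol, h]

lemma rep_neg_of_not_cone {u : EuclideanSpace ℝ (Fin 3)} (hu : Cone u.ofLp)
    (h : ¬ Cone (-u).ofLp) : rep (-u) = rep u := by
  rw [rep_of_cone hu]
  refine (if_neg h).trans ?_
  rw [neg_neg]

lemma iterate_bToB_congr_rep {r : ℝ} {u v : EuclideanSpace ℝ (Fin 3)} (h : rep u = rep v)
    {n : ℕ} (hn : n ≠ 0) : (bToB r)^[n] u = (bToB r)^[n] v := by
  obtain ⟨n, rfl⟩ := Nat.exists_eq_succ_of_ne_zero hn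
  rw [Function.iterate_succ_apply, Function.iterate_succ_apply, bToB_congr_rep h]

/-- The representative in the cone of a point that generates the pattern is periodic. -/
lemma pattern_of_generates {r : ℝ} (hr0 : 0 < r) {u u' : EuclideanSpace ℝ (Fin 3)}
    (hu' : u' ∈ sphereCone) (hrep : rep u = rep u') (huu : u = u' ∨ u = -u')
    (h : Generates r [1, 3, 2, 2, 3, 1, 2, 2] u) :
    (∀ k (hk : k < pattern.length), cycle r ((bToB r)^[k] u').ofLp = pattern[k]) ∧
      (bToB r)^[8] u' = u' := by
  obtain ⟨hs, hper⟩ := h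
  have hpat : ∀ k (hk : k < pattern.length), cycle r ((bToB r)^[k] u').ofLp = pattern[k] := by
    intro k hk
    have h1 := hs k (by simpa [pattern] using hk)
    have h2 : symbol r ((bToB r)^[k] u) = symbol r ((bToB r)^[k] u') := by
      rcases eq_or_ne k 0 with rfl | hk0
      · exact symbol_congr_rep hrep
      · rw [iterate_bToB_congr_rep hrep hk0]
    rw [h2, symbol_eq hr0 (iterate_bToB_mem hr0 hu' k).2] at h1
    have hk : k < 8 := hk
    generalize cycle r ((bToB r)^[k] u').ofLp = s at h1
    interval_cases k <;> fin_cases s <;> simp_all [pattern]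
  refine ⟨hpat, ?_⟩
  have h8 : (bToB r)^[8] u' = u' ∨ (bToB r)^[8] u' = -u' := by
    have : (bToB r)^[8] u = u ∨ (bToB r)^[8] u = -u := hper
    rw [iterate_bToB_congr_rep hrep (by norm_num)] at this
    rcases huu with rfl | rfl
    · exact this
    · rw [neg_neg] at this; exact this.symm
  refine h8.resolve_right fun h8 => ?_
  have hneg := (iterate_bToB_mem hr0 hu' 8).2
  -- Now `u'` and `-u'` both lie in the cone, so `u'` is on the second axis.
  rw [h8] at hneg
  have h0 : u' 0 = 0 := le_antisymm (neg_nonneg.1 hneg.1) hu'.2.1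
  have h2 : u' 2 = 0 := le_antisymm hu'.2.2 (neg_nonpos.1 hneg.2)
  have c0 := cycle_wordMap hr0 (l₁ := []) (s := 0) (l₂ := [2, 1, 1, 2, 0, 1, 1]) hu' hpat
  have c1 := cycle_wordMap hr0 (l₁ := [0]) (s := 2) (l₂ := [1, 1, 2, 0, 1, 1]) hu' hpat
  simp only [wordMap, ContinuousLinearMap.comp_apply, ContinuousLinearMap.id_apply,
    ofLp_blockMap] at c0 c1
  exact not_pattern_of_axis hr0 h0 h2 c0.1 c1.2 c1.1

lemma exists_representative {u : EuclideanSpace ℝ (Fin 3)} (hu : u ∈ X) :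
    ∃ u' ∈ sphereCone, rep u = rep u' ∧ (u = u' ∨ u = -u') := by
  obtain ⟨hn, hu⟩ := hu
  by_cases h : Cone u.ofLp
  · exact ⟨u, ⟨hn, h⟩, rfl, .inl rfl⟩
  · have hc : Cone (-u).ofLp := by
      rcases hu with hu | hu
      · exact absurd hu h
      · exact ⟨neg_nonneg.2 hu.1, neg_nonpos.2 hu.2⟩
    refine ⟨-u, ⟨by rwa [norm_neg], hc⟩, ?_, .inr (neg_neg u).symm⟩
    have := rep_neg_of_not_cone hc (by rwa [neg_neg])
    rwa [neg_neg] at this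

end FourParticles

open FourParticles in
theorem mainTheorem3 (r : ℝ) (hr : r ∈ Set.Ioo (0 : ℝ) 1) :
    ¬ ∃ u ∈ FourParticles.X, FourParticles.Generates r [1, 3, 2, 2, 3, 1, 2, 2] u ∧
      (FourParticles.LyapunovStable r u ∨ FourParticles.LocallyAttracting r u) := by
  rintro ⟨u, hu, hgen, hstable⟩
  obtain ⟨u', hu', hrep, huu⟩ := exists_representative hu
  obtain ⟨hpat, hper⟩ := pattern_of_generates hr.1 hu' hrep huu hgen
  obtain ⟨ε, hε, hesc⟩ := exists_escaping hr.1 hr.2 hu' hpat hper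
  obtain ⟨δ, hδ, hδ'⟩ := eventually_dist_lt_of_stable hstable hε
  obtain ⟨v', hv', hv0, hd, hnot⟩ := hesc δ hδ
  -- On the second axis `rep` does not identify `v'` with `-v'`. The condition `0 < v' 0` avoids
  -- this, so `-v'` can replace `v'` when `u = -u'`.
  have hnc : ¬ Cone (-v').ofLp := fun h => (neg_nonneg.1 h.1).not_gt hv0
  have hv : ∃ v ∈ X, dist v u < δ ∧ rep v = rep v' := by
    rcases huu with rfl | rfl
    · exact ⟨v', mem_X_of_mem_sphereCone hv', hd, rfl⟩
    · exact ⟨-v', neg_mem_X_of_mem_sphereCone hv', by rwa [dist_neg_neg],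
        rep_neg_of_not_cone hv'.2 hnc⟩
  obtain ⟨v, hvX, hvd, hvrep⟩ := hv
  obtain ⟨K, hK⟩ := hδ' v hvX hvd
  -- Points with the same representative share iterates only from the first one on, hence `K + 1`.
  refine hnot ⟨K + 1, fun n hn => ?_⟩
  have hn0 : n ≠ 0 := by omega
  rw [← iterate_bToB_congr_rep hvrep hn0, ← iterate_bToB_congr_rep hrep hn0]
  exact hK n (by omega)
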